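/- Consider an uplink with $K$ users, $N$ resource blocks (RBs), $N_r$ receive antennas and $N_t$ transmit antennas per user. Let $H_k^{(n)}\in\mathbb C^{N_r\times N_t}$ be the channel matrix of user $k$ on RB $n$ and $P_k\ge 0$ the power budget of user $k$. Let $\mathcal C\subseteq\{0,1\}^N$ be a set of RB assignments, $\mathcal W\subset\mathbb C^{N_t\times N_t}$ a finite codebook of precoders, and $\mathcal E=\{1,\dots,K\}\times\mathcal C\times\mathcal W$. For $e=(u,c,W)\in\mathcal E$ put $c_e=c$, $W_e=W$, $H_e^{(n)}=H_u^{(n)}$ and $p_e=P_u/\sum_{i=1}^N c(i)$ (if $c=0$, put $p_e=0$), and let $\mathcal S_e\subset\mathbb C$ be a finite constellation of cardinality $S_e$ and unit average energy, $\frac1{S_e}\sum_{z\in\mathcal S_e}|z|^2=1$. For $A\subseteq\mathcal E$ and $1\le n\le N$ let $I^{(n)}(A)$ be the mutual information between the inputs $(x_e)_{e\in A}$ and the output $$y=\sum_{e\in A}\sqrt{p_e}\,c_e(n)H_e^{(n)}W_e x_e+v,$$ where the entries of $x_e$ are independent and uniform on $\mathcal S_e$, the vectors $x_e$, $e\in A$,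 are mutually independent, and $v\sim\mathcal{CN}(0,I)$ is independent of the inputs. (Mutual information and $\log$ are taken to the same base.) Then for all $A\subseteq\mathcal E$ and $1\le n\le N$, $$I^{(n)}(A)\le g^{(n)}(A):=\min_{R\subseteq A}\Big\{\log\det\Big(I+\sum_{e\in A\setminus R}p_e c_e(n)H_e^{(n)}W_e(H_e^{(n)}W_e)^\dagger\Big)+\sum_{e\in R}N_t\log S_e\Big\}.$$ Moreover, the function $g(A)=\sum_{n=1}^N g^{(n)}(A)$ on the subsets of $\mathcal E$ is a rank function: it takes values in $[0,\infty)$, $g(\emptyset)=0$, $g(A)\le g(B)$ whenever $A\subseteq B$, and $g(A\cup\{e\})-g(A)\ge g(B\cup\{e\})-g(B)$ for all $A\subseteq B\subseteq\mathcal E$ and $e\in\mathcal E$. -/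

import Mathlib

open MeasureTheory ProbabilityTheory Matrix
open scoped ENNReal

noncomputable section

namespace Uplink

/-- Data of a single-cell uplink with `K` users, `N` resource blocks (RBs), `Nr` receive antennas
and `Nt` transmit antennas per user. The ground set consists of all triples
(user, RB assignment, precoder). -/
structure System (K N Nr Nt : ℕ) where
  /-- the channel matrix of user `k` on RB `n` -/
  channel : Fin K → Fin N → Matrix (Fin Nr) (Fin Nt) ℂ
  /-- the power budget of user `k` -/
  budget : Fin K → ℝ
  /-- the valid RB assignments, as binary vectors -/
  assignments : Finset (Fin N → Fin 2)
  /-- the codebook of precoders -/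
  codebook : Finset (Matrix (Fin Nt) (Fin Nt) ℂ)
  /-- the constellation used by each element of the ground set -/
  constellation : Fin K × {c // c ∈ assignments} × {W // W ∈ codebook} → Finset ℂ

variable {K N Nr Nt : ℕ}

/-- The ground set of elements `e = (u, c, W)`. -/
abbrev System.Element (s : System K N Nr Nt) : Type :=
  Fin K × {c // c ∈ s.assignments} × {W // W ∈ s.codebook}

/-- `c_e(n)`, a number equal to `0` or `1`. -/
def System.alloc (s : System K N Nr Nt) (e : s.Element) (n : Fin N) : ℝ :=
  ((e.2.1.1 n : ℕ) : ℝ)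

/-- The power level `p_e`: the budget of the user divided by the number of RBs in `c_e`.
(For the zero assignment the value is irrelevant, since then `c_e(n) = 0` for all `n`.) -/
def System.psd (s : System K N Nr Nt) (e : s.Element) : ℝ :=
  s.budget e.1 / ∑ n, s.alloc e n

/-- The effective channel `H_e^{(n)} W_e`. -/
def System.effChannel (s : System K N Nr Nt) (n : Fin N) (e : s.Element) :
    Matrix (Fin Nr) (Fin Nt) ℂ :=
  s.channel e.1 n * e.2.2.1

/-- The constellation of every element has unit average energy. -/
def System.UnitEnergy (s : System K N Nr Nt) : Prop :=
  ∀ e : s.Element, (∑ z ∈ s.constellation e, ‖z‖ ^ 2) / ((s.constellation e).card : ℝ) = 1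

/-- The mutual information `I(X; Y)` in nats of two random variables on a probability space. -/
def mutualInfo {Ω 𝓧 𝓨 : Type*} [MeasurableSpace Ω] [MeasurableSpace 𝓧] [MeasurableSpace 𝓨]
    (μ : Measure Ω) (X : Ω → 𝓧) (Y : Ω → 𝓨) : ℝ≥0∞ :=
  InformationTheory.klDiv (μ.map fun ω => (X ω, Y ω)) ((μ.map X).prod (μ.map Y))

/-- The law `CN(0, 1)`: independent real and imaginary parts, both `N(0, 1/2)`. -/
def complexGaussian : Measure ℂ :=
  ((gaussianReal 0 (1 / 2)).prod (gaussianReal 0 (1 / 2))).map fun z => (⟨z.1, z.2⟩ : ℂ)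

/-- The law `CN(0, I)` of the noise vector. -/
def noiseLaw (Nr : ℕ) : Measure (Fin Nr → ℂ) :=
  Measure.pi fun _ => complexGaussian

/-- The joint law of the inputs `x_e`, `e ∈ A`: these are independent, and the entries of `x_e`
are independent and uniform on the constellation of `e`. -/
def System.inputLaw (s : System K N Nr Nt) (A : Finset s.Element) :
    Measure ((e : A) → Fin Nt → ℂ) :=
  Measure.pi fun e => Measure.pi fun _ => uniformOn (s.constellation e.1 : Set ℂ)

/-- The channel output `y = ∑_{e ∈ A} √p_e c_e(n) H_e^{(n)} W_e x_e + v`. -/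
def System.output (s : System K N Nr Nt) (n : Fin N) (A : Finset s.Element)
    (x : (e : A) → Fin Nt → ℂ) (v : Fin Nr → ℂ) : Fin Nr → ℂ :=
  ∑ e : A, ((Real.sqrt (s.psd e.1) * s.alloc e.1 n : ℝ) : ℂ) • (s.effChannel n e.1 *ᵥ x e) + v

/-- `I^{(n)}(A)`: the mutual information between the inputs `(x_e)_{e ∈ A}` and the output on RB
`n`, the noise being independent of the inputs. -/
def System.info (s : System K N Nr Nt) (n : Fin N) (A : Finset s.Element) : ℝ≥0∞ :=
  mutualInfo ((s.inputLaw A).prod (noiseLaw Nr)) (fun ω => ω.1) (fun ω => s.output n A ω.1 ω.2)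

/-- `log det (I + ∑_{e ∈ A} p_e c_e(n) H_e W_e (H_e W_e)†)`, the determinant being a positive
real number. -/
def System.logDet (s : System K N Nr Nt) (n : Fin N) (A : Finset s.Element) : ℝ :=
  Real.log (1 + ∑ e ∈ A, ((s.psd e * s.alloc e n : ℝ) : ℂ) •
    (s.effChannel n e * (s.effChannel n e)ᴴ)).det.re

open Classical in
/-- `g^{(n)}(A)`. -/
def System.gRB (s : System K N Nr Nt) (n : Fin N) (A : Finset s.Element) : ℝ :=
  A.powerset.inf' ⟨∅, Finset.empty_mem_powerset A⟩ fun R =>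
    s.logDet n (A \ R) + ∑ e ∈ R, (Nt : ℝ) * Real.log ((s.constellation e).card : ℝ)

/-- `g(A) = ∑_n g^{(n)}(A)`. -/
def System.g (s : System K N Nr Nt) (A : Finset s.Element) : ℝ :=
  ∑ n, s.gRB n A

open Classical in
/-- Rank functions: nonnegative, normalized, monotone and submodular set functions. -/
structure IsRankFunction {E : Type*} (f : Finset E → ℝ) : Prop where
  nonneg : ∀ A, 0 ≤ f A
  normalized : f ∅ = 0
  monotone : ∀ A B, A ⊆ B → f A ≤ f B
  submodular : ∀ A B, A ⊆ B → ∀ e, f (B ∪ {e}) - f B ≤ f (A ∪ {e}) - f A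

end Uplink

end

/-!
With `ξ` the symbols outside `R`, centred, the output on one RB is `Y = m(X) + B ξ + v`, where
`m(X)` replaces these symbols by their means and so depends only on the symbols in `R`. Then
`I(X; Y) ≤ D(P_{XY} ‖ P_X ⊗ ν)` for every law `ν`. Let `Q` be the law of `(X, m(X) + w)` with
`w ∼ CN(0, I + B Bᴴ)` independent of `X`, and let `ν` be the output law of `Q`. The symbols in `R`
take `M = ∏_{e ∈ R} S_e ^ Nt` equally likely values, so `Q ≤ M • (P_X ⊗ ν)`, whence
`D(P_{XY} ‖ P_X ⊗ ν) ≤ log M + D(P_{XY} ‖ Q)`. Writing `I + B Bᴴ = F Fᴴ`, whitening by `F⁻¹` gives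
`D(P_{XY} ‖ Q) ≤ log det (I + B Bᴴ) + E ‖F⁻¹ (B ξ + v)‖² - E ‖v‖²`, where the first energy is at
most the second because `B ξ + v` has covariance at most `F Fᴴ`.

For the rank function, `log det (I + ·)` of a sum of positive semidefinite matrices is submodular
because inversion is antitone, and the convolution `A ↦ min_{R ⊆ A} (f (A \ R) + w R)` of a
normalized, monotone, submodular `f` with a nonnegative additive `w` has the same properties.
-/

namespace Uplink

section Information

open InformationTheory

variable {Ω 𝓧 𝓨 : Type*} {mΩ : MeasurableSpace Ω} {m𝓧 : MeasurableSpace 𝓧}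
  {m𝓨 : MeasurableSpace 𝓨}

-- The chain rule with `Y` disintegrated first splits off `klDiv P_Y ν`.
lemma mutualInfo_le_klDiv_prod [StandardBorelSpace 𝓧] (μ : Measure Ω) [IsProbabilityMeasure μ]
    {X : Ω → 𝓧} {Y : Ω → 𝓨} (hX : Measurable X) (hY : Measurable Y) (ν : Measure 𝓨)
    [IsFiniteMeasure ν] :
    mutualInfo μ X Y ≤ klDiv (μ.map fun ω => (X ω, Y ω)) ((μ.map X).prod ν) := by
  have : Nonempty 𝓧 := (nonempty_of_isProbabilityMeasure μ).map X
  have := Measure.isProbabilityMeasure_map (μ := μ) hX.aemeasurable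
  have := Measure.isProbabilityMeasure_map (μ := μ) hY.aemeasurable
  have := Measure.isProbabilityMeasure_map (μ := μ) (hY.prodMk hX).aemeasurable
  have hjoint : μ.map Y ⊗ₘ condDistrib X Y μ = μ.map fun ω => (Y ω, X ω) :=
    compProd_map_condDistrib hX.aemeasurable
  have hchain := klDiv_compProd_eq_add (μ.map Y) ν (condDistrib X Y μ) (Kernel.const 𝓨 (μ.map X))
  rw [hjoint, Measure.compProd_const, Measure.compProd_const] at hchain
  have hswap : (μ.map fun ω => (Y ω, X ω)).map Prod.swap = μ.map fun ω => (X ω, Y ω) :=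
    Measure.map_map measurable_swap (hY.prodMk hX)
  have hswap' : (μ.map fun ω => (X ω, Y ω)).map Prod.swap = μ.map fun ω => (Y ω, X ω) :=
    Measure.map_map measurable_swap (hX.prodMk hY)
  calc mutualInfo μ X Y
      = klDiv ((μ.map fun ω => (Y ω, X ω)).map Prod.swap)
          (((μ.map Y).prod (μ.map X)).map Prod.swap) := by
        rw [hswap, Measure.prod_swap, mutualInfo]
    _ ≤ klDiv (μ.map fun ω => (Y ω, X ω)) ((μ.map Y).prod (μ.map X)) :=
        klDiv_map_le _ _ measurable_swap
    _ ≤ klDiv (μ.map fun ω => (Y ω, X ω)) (ν.prod (μ.map X)) := hchain ▸ le_add_self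
    _ = klDiv ((μ.map fun ω => (X ω, Y ω)).map Prod.swap)
          (((μ.map X).prod ν).map Prod.swap) := by rw [hswap', Measure.prod_swap]
    _ ≤ klDiv (μ.map fun ω => (X ω, Y ω)) ((μ.map X).prod ν) :=
        klDiv_map_le _ _ measurable_swap

-- With `a = dP/dη` and `d = dη/dν`, this integrates to `klDiv P ν ≤ klDiv P η + log M`; both sides
-- are moved so that no subtraction occurs, which lets the inequality pass to `ℝ≥0∞`.
lemma klFun_mul_add_le {a d M : ℝ} (ha : 0 ≤ a) (hd : 0 ≤ d) (hdM : d ≤ M) :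
    klFun (a * d) + d ≤ d * klFun a + a * d * Real.log M + 1 := by
  rcases hd.eq_or_lt with rfl | hd
  · simp [klFun_zero]
  rcases ha.eq_or_lt with rfl | ha
  · simp [klFun_zero, add_comm]
  have hlog : Real.log d ≤ Real.log M := Real.log_le_log hd hdM
  have hle : a * d * Real.log d ≤ a * d * Real.log M := by gcongr
  simp only [klFun, Real.log_mul ha.ne' hd.ne']
  linarith

lemma ofReal_klFun_mul_add_le (a : ℝ≥0∞) {d : ℝ≥0∞} {M : NNReal} (hM : (1 : ℝ) ≤ M)
    (hdM : d ≤ M) :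
    ENNReal.ofReal (klFun (a * d).toReal) + d ≤
      d * ENNReal.ofReal (klFun a.toReal) + a * d * ENNReal.ofReal (Real.log M) + 1 := by
  lift d to NNReal using ne_top_of_le_ne_top ENNReal.coe_ne_top hdM
  induction a with
  | top => simp [klFun_zero, ENNReal.toReal_mul, add_right_comm, add_comm (1 : ℝ≥0∞)]
  | coe a =>
    have hlog := Real.log_nonneg hM
    have hklFun := klFun_nonneg a.coe_nonneg
    have hreal := ENNReal.ofReal_le_ofReal
      (klFun_mul_add_le a.coe_nonneg d.coe_nonneg (by exact_mod_cast hdM : (d : ℝ) ≤ M))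
    rw [ENNReal.ofReal_add (klFun_nonneg (by positivity)) (by positivity),
      ENNReal.ofReal_add (by positivity) zero_le_one, ENNReal.ofReal_add (by positivity)
      (by positivity), ENNReal.ofReal_mul (by positivity), ENNReal.ofReal_mul (by positivity),
      ENNReal.ofReal_mul (by positivity)] at hreal
    simpa using hreal

lemma klDiv_le_log_add_klDiv {P η ν : Measure Ω} [IsProbabilityMeasure P]
    [IsProbabilityMeasure η] [IsProbabilityMeasure ν] {M : NNReal} (h : η ≤ M • ν) :
    klDiv P ν ≤ ENNReal.ofReal (Real.log M) + klDiv P η := by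
  by_cases hPη : P ≪ η
  swap
  · simp [klDiv_of_not_ac hPη]
  have hην : η ≪ ν := (Measure.absolutelyContinuous_of_le h).trans
    Measure.smul_absolutelyContinuous
  have hM : (1 : ℝ) ≤ M := by simpa using h Set.univ
  have hd : ∀ᵐ ω ∂ν, η.rnDeriv ν ω ≤ M := by
    refine ae_le_of_forall_setLIntegral_le_of_sigmaFinite (Measure.measurable_rnDeriv η ν)
      fun s _ _ => (Measure.setLIntegral_rnDeriv_le s).trans ?_
    simpa using h s
  have hpt : ∀ᵐ ω ∂ν, ENNReal.ofReal (klFun (P.rnDeriv ν ω).toReal) + η.rnDeriv ν ω ≤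
      η.rnDeriv ν ω * ENNReal.ofReal (klFun (P.rnDeriv η ω).toReal) +
        P.rnDeriv ν ω * ENNReal.ofReal (Real.log M) + 1 := by
    filter_upwards [hd, Measure.rnDeriv_mul_rnDeriv (κ := ν) hPη] with ω hω hmul
    simpa only [← hmul, Pi.mul_apply] using ofReal_klFun_mul_add_le _ hM hω
  have hint := lintegral_mono_ae hpt
  rw [lintegral_add_right _ (by fun_prop), lintegral_add_right _ (by fun_prop),
    lintegral_add_right _ (by fun_prop), lintegral_mul_const _ (by fun_prop),
    Measure.lintegral_rnDeriv hην, Measure.lintegral_rnDeriv (hPη.trans hην),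
    lintegral_rnDeriv_mul hην (by fun_prop), ← klDiv_eq_lintegral_klFun_of_ac hPη,
    ← klDiv_eq_lintegral_klFun_of_ac (hPη.trans hην)] at hint
  simp only [measure_univ, lintegral_const, one_mul] at hint
  rw [add_comm (ENNReal.ofReal _)]
  exact (ENNReal.add_le_add_iff_right ENNReal.one_ne_top).1 hint

lemma klDiv_withDensity_ofReal {Q : Measure Ω} [IsProbabilityMeasure Q] {f : Ω → ℝ}
    (hf : Measurable f) (hpos : ∀ ω, 0 < f ω)
    [IsProbabilityMeasure (Q.withDensity fun ω => ENNReal.ofReal (f ω))]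
    (hint : Integrable (fun ω => Real.log (f ω))
      (Q.withDensity fun ω => ENNReal.ofReal (f ω))) :
    klDiv (Q.withDensity fun ω => ENNReal.ofReal (f ω)) Q =
      ENNReal.ofReal (∫ ω, Real.log (f ω) ∂(Q.withDensity fun ω => ENNReal.ofReal (f ω))) := by
  set P := Q.withDensity fun ω => ENNReal.ofReal (f ω)
  have hPQ : P ≪ Q := withDensity_absolutelyContinuous _ _
  have hllr : llr P Q =ᵐ[P] fun ω => Real.log (f ω) := by
    filter_upwards [hPQ.ae_le (Measure.rnDeriv_withDensity Q hf.ennreal_ofReal)] with ω hω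
    rw [llr, hω, ENNReal.toReal_ofReal (hpos ω).le]
  rw [klDiv_of_ac_of_integrable hPQ ((integrable_congr hllr).2 hint), integral_congr_ae hllr]
  simp

lemma map_prodMk_eq_withDensity {μ : Measure 𝓧} {ν : Measure 𝓨} [SFinite μ] [SFinite ν]
    {T : 𝓧 → 𝓨 → 𝓨} {f : 𝓧 → 𝓨 → ℝ≥0∞} (hT : Measurable (Function.uncurry T))
    (hf : Measurable (Function.uncurry f)) (h : ∀ x, ν.map (T x) = ν.withDensity (f x)) :
    (μ.prod ν).map (fun p => (p.1, T p.1 p.2)) =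
      (μ.prod ν).withDensity (Function.uncurry f) := by
  have hTm : Measurable fun p : 𝓧 × 𝓨 => (p.1, T p.1 p.2) := measurable_fst.prodMk hT
  ext s hs
  rw [Measure.map_apply hTm hs, Measure.prod_apply (hTm hs), withDensity_apply _ hs,
    ← lintegral_indicator hs, lintegral_prod _ (hf.indicator hs).aemeasurable]
  refine lintegral_congr fun x => ?_
  have hsx : MeasurableSet (Prod.mk x ⁻¹' s) := measurable_prodMk_left hs
  have hTx : Measurable (T x) := hT.comp measurable_prodMk_left
  calc ν (T x ⁻¹' (Prod.mk x ⁻¹' s)) = ∫⁻ y in Prod.mk x ⁻¹' s, f x y ∂ν := by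
        rw [← Measure.map_apply hTx hsx, h, withDensity_apply _ hsx]
    _ = ∫⁻ y, s.indicator (Function.uncurry f) (x, y) ∂ν := by
        rw [← lintegral_indicator hsx]; rfl

lemma map_prodMk_le_smul_prod {μ : Measure 𝓧} {ρ : Measure Ω} [SFinite μ]
    [SFinite ρ] {𝓩 : Type*} {T : 𝓧 → 𝓩} {Ψ : 𝓧 → Ω → 𝓨}
    (hΨ : Measurable (Function.uncurry Ψ)) (hT : ∀ x x', T x = T x' → Ψ x = Ψ x') {M : NNReal}
    (hM : ∀ᵐ x ∂μ, 1 ≤ M * μ {x' | T x' = T x}) :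
    (μ.prod ρ).map (fun p => (p.1, Ψ p.1 p.2)) ≤
      M • μ.prod ((μ.prod ρ).map (Function.uncurry Ψ)) := by
  have hpair : Measurable fun p : 𝓧 × Ω => (p.1, Ψ p.1 p.2) := measurable_fst.prodMk hΨ
  refine Measure.le_iff.2 fun s hs => ?_
  rw [Measure.map_apply hpair hs, Measure.prod_apply (hpair hs), Measure.smul_apply,
    Measure.prod_apply hs, ENNReal.smul_def, smul_eq_mul,
    ← lintegral_const_mul _ (measurable_measure_prodMk_left hs)]
  refine lintegral_mono_ae (hM.mono fun x hx => ?_)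
  have hsx : MeasurableSet (Prod.mk x ⁻¹' s) := measurable_prodMk_left hs
  set t := Ψ x ⁻¹' (Prod.mk x ⁻¹' s)
  have hsub : {x' | T x' = T x} ×ˢ t ⊆ Function.uncurry Ψ ⁻¹' (Prod.mk x ⁻¹' s) := by
    rintro ⟨x', v⟩ ⟨hx', hv⟩
    change (x, Ψ x' v) ∈ s
    rw [hT x' x hx']
    exact hv
  calc ρ t ≤ M * μ {x' | T x' = T x} * ρ t := le_mul_of_one_le_left' hx
    _ = M * μ.prod ρ ({x' | T x' = T x} ×ˢ t) := by rw [Measure.prod_prod, mul_assoc]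
    _ ≤ M * μ.prod ρ (Function.uncurry Ψ ⁻¹' (Prod.mk x ⁻¹' s)) := by gcongr
    _ = M * (μ.prod ρ).map (Function.uncurry Ψ) (Prod.mk x ⁻¹' s) := by
        rw [Measure.map_apply hΨ hsx]

end Information

section LogDet

open scoped ComplexOrder MatrixOrder Matrix.Norms.L2Operator

variable {m : Type*} {X Y Z : Matrix m m ℂ}

lemma posDef_of_le (hX : X.PosDef) (hXY : X ≤ Y) : Y.PosDef := by
  simpa only [add_sub_cancel] using hX.add_posSemidef (le_iff.1 hXY)

variable [Fintype m]

lemma exists_eq_mul_conjTranspose (hX : X.PosSemidef) : ∃ F : Matrix m m ℂ, X = F * Fᴴ := by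
  classical
  obtain ⟨B, rfl⟩ := CStarAlgebra.nonneg_iff_eq_star_mul_self.mp hX.nonneg
  exact ⟨star B, by rw [star_eq_conjTranspose, conjTranspose_conjTranspose]⟩

variable [DecidableEq m]

lemma inv_le_inv_of_posDef (hX : X.PosDef) (hXY : X ≤ Y) : Y⁻¹ ≤ X⁻¹ := by
  have hY := posDef_of_le hX hXY
  simpa only [coe_units_inv, IsUnit.unit_spec] using
    CStarAlgebra.inv_le_inv (a := hX.isUnit.unit) (b := hY.isUnit.unit) hX.posSemidef.nonneg hXY

lemma one_le_det (hX : 1 ≤ X) : 1 ≤ X.det := by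
  have hH : X.IsHermitian := by simpa using (le_iff.1 hX).1.add isHermitian_one
  have hone : ∀ i, 1 ≤ hH.eigenvalues i := fun i =>
    (algebraMap_le_iff_le_spectrum (r := (1 : ℝ)) (a := X) (ha := hH)).1 (by simpa using hX) _
      (hH.eigenvalues_mem_spectrum_real i)
  have hprod : ((1 : ℝ) : ℂ) ≤ ((∏ i, hH.eigenvalues i : ℝ) : ℂ) :=
    Complex.real_le_real.2 (Finset.one_le_prod fun i _ => hone i)
  simpa [hH.det_eq_prod_eigenvalues] using hprod

lemma det_le_det_of_posDef (hX : X.PosDef) (hXY : X ≤ Y) : X.det ≤ Y.det := by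
  obtain ⟨F, hF⟩ := exists_eq_mul_conjTranspose (le_iff.1 hXY)
  have hone : 1 ≤ 1 + Fᴴ * X⁻¹ * F :=
    le_add_of_nonneg_right (hX.inv.posSemidef.conjTranspose_mul_mul_same F).nonneg
  calc X.det ≤ X.det * (1 + Fᴴ * X⁻¹ * F).det :=
        le_mul_of_one_le_right hX.det_pos.le (one_le_det hone)
    _ = Y.det := by
        rw [← det_add_mul _ _ hX.det_pos.ne'.isUnit, ← hF, add_sub_cancel]

lemma det_add_mul_det_le (hX : X.PosDef) (hXY : X ≤ Y) (hZ : Z.PosSemidef) :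
    (Y + Z).det * X.det ≤ (X + Z).det * Y.det := by
  obtain ⟨F, rfl⟩ := exists_eq_mul_conjTranspose hZ
  have hY := posDef_of_le hX hXY
  have hpos : (1 + Fᴴ * Y⁻¹ * F).PosDef :=
    PosDef.one.add_posSemidef (hY.inv.posSemidef.conjTranspose_mul_mul_same F)
  have hle : 1 + Fᴴ * Y⁻¹ * F ≤ 1 + Fᴴ * X⁻¹ * F := by
    gcongr
    exact star_left_conjugate_le_conjugate (inv_le_inv_of_posDef hX hXY) F
  have hdet := det_le_det_of_posDef hpos hle
  rw [det_add_mul _ _ hX.det_pos.ne'.isUnit, det_add_mul _ _ hY.det_pos.ne'.isUnit]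
  calc Y.det * (1 + Fᴴ * Y⁻¹ * F).det * X.det
      = X.det * Y.det * (1 + Fᴴ * Y⁻¹ * F).det := by ring
    _ ≤ X.det * Y.det * (1 + Fᴴ * X⁻¹ * F).det :=
        mul_le_mul_of_nonneg_left hdet (mul_nonneg hX.det_pos.le hY.det_pos.le)
    _ = X.det * (1 + Fᴴ * X⁻¹ * F).det * Y.det := by ring

lemma re_det_pos (hX : X.PosDef) : 0 < X.det.re :=
  (Complex.lt_def.1 hX.det_pos).1

lemma ofReal_re_det (hX : X.PosDef) : (X.det.re : ℂ) = X.det :=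
  Complex.ext rfl (Complex.lt_def.1 hX.det_pos).2

lemma log_re_det_mono (hX : X.PosDef) (hXY : X ≤ Y) :
    Real.log X.det.re ≤ Real.log Y.det.re :=
  Real.log_le_log (re_det_pos hX) (Complex.le_def.1 (det_le_det_of_posDef hX hXY)).1

lemma log_re_det_add_add_le (hX : X.PosDef) (hXY : X ≤ Y) (hZ : Z.PosSemidef) :
    Real.log (Y + Z).det.re + Real.log X.det.re ≤
      Real.log (X + Z).det.re + Real.log Y.det.re := by
  have hY := posDef_of_le hX hXY
  have hXZ := hX.add_posSemidef hZ
  have hYZ := hY.add_posSemidef hZ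
  have hdet := det_add_mul_det_le hX hXY hZ
  rw [← ofReal_re_det hX, ← ofReal_re_det hY, ← ofReal_re_det hXZ, ← ofReal_re_det hYZ] at hdet
  rw [← Real.log_mul (re_det_pos hYZ).ne' (re_det_pos hX).ne',
    ← Real.log_mul (re_det_pos hXZ).ne' (re_det_pos hY).ne']
  exact Real.log_le_log (mul_pos (re_det_pos hYZ) (re_det_pos hX)) (mod_cast hdet)

end LogDet

section Gaussian

lemma pi_withDensity_ofReal {ι E : Type*} [Fintype ι] [MeasureSpace E]
    [SigmaFinite (volume : Measure E)] {φ : E → ℝ} (hφ : Integrable φ) (hφ0 : ∀ x, 0 ≤ φ x) :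
    Measure.pi (fun _ : ι => (volume : Measure E).withDensity fun x => ENNReal.ofReal (φ x)) =
      (volume : Measure (ι → E)).withDensity fun y => ENNReal.ofReal (∏ i, φ (y i)) := by
  have : IsFiniteMeasure ((volume : Measure E).withDensity fun x => ENNReal.ofReal (φ x)) :=
    isFiniteMeasure_withDensity_ofReal hφ.2
  refine Measure.pi_eq fun s hs => ?_
  rw [withDensity_apply _ (MeasurableSet.univ_pi hs), volume_pi, Measure.restrict_pi_pi,
    ← ofReal_integral_eq_lintegral_ofReal
      (Integrable.fintype_prod fun i => hφ.restrict)
      (Filter.Eventually.of_forall fun y => Finset.prod_nonneg fun i _ => hφ0 _),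
    integral_fintype_prod_eq_prod (fun _ => φ),
    ENNReal.ofReal_prod_of_nonneg fun i _ => integral_nonneg hφ0]
  refine Finset.prod_congr rfl fun i _ => ?_
  rw [withDensity_apply _ (hs i), ofReal_integral_eq_lintegral_ofReal hφ.restrict
    (Filter.Eventually.of_forall hφ0)]

lemma complexGaussian_eq_map : complexGaussian =
    ((gaussianReal 0 (1 / 2)).prod (gaussianReal 0 (1 / 2))).map
      Complex.measurableEquivRealProd.symm := rfl

/-- The density of the law `CN(0, 1)`. -/
noncomputable def complexGaussianPDF (z : ℂ) : ℝ := Real.pi⁻¹ * Real.exp (-‖z‖ ^ 2)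

lemma complexGaussianPDF_nonneg (z : ℂ) : 0 ≤ complexGaussianPDF z := by
  unfold complexGaussianPDF; positivity

lemma measurable_complexGaussianPDF : Measurable complexGaussianPDF := by
  unfold complexGaussianPDF; fun_prop

lemma complexGaussian_eq_withDensity :
    complexGaussian =
      (volume : Measure ℂ).withDensity fun z => ENNReal.ofReal (complexGaussianPDF z) := by
  have hv : (1 / 2 : NNReal) ≠ 0 := by norm_num
  rw [complexGaussian_eq_map, gaussianReal_of_var_ne_zero 0 hv,
    prod_withDensity (measurable_gaussianPDF _ _) (measurable_gaussianPDF _ _)]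
  ext t ht
  rw [MeasurableEquiv.map_apply, withDensity_apply _ (MeasurableEquiv.measurable _ ht),
    withDensity_apply _ ht,
    ← Complex.volume_preserving_equiv_real_prod.symm.setLIntegral_comp_preimage_emb
      (MeasurableEquiv.measurableEmbedding _)]
  refine lintegral_congr fun z => ?_
  rw [gaussianPDF, gaussianPDF, ← ENNReal.ofReal_mul (gaussianPDFReal_nonneg _ _ _)]
  congr 1
  have hden : (2 * Real.pi * ((1 / 2 : NNReal) : ℝ)) = Real.pi := by push_cast; ring
  have hexp : (2 * ((1 / 2 : NNReal) : ℝ)) = 1 := by push_cast; ring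
  simp only [gaussianPDFReal, complexGaussianPDF, hden, hexp,
    Complex.measurableEquivRealProd_symm_apply]
  rw [Complex.sq_norm, Complex.normSq_mk, mul_mul_mul_comm, ← mul_inv,
    Real.mul_self_sqrt Real.pi_pos.le, ← Real.exp_add]
  congr 2
  ring

instance : IsProbabilityMeasure complexGaussian := by
  rw [complexGaussian_eq_map]
  exact Measure.isProbabilityMeasure_map (MeasurableEquiv.measurable _).aemeasurable

instance (Nr : ℕ) : IsProbabilityMeasure (noiseLaw Nr) := by
  unfold noiseLaw; infer_instance

lemma integrable_complexGaussianPDF : Integrable complexGaussianPDF := by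
  refine ⟨measurable_complexGaussianPDF.aestronglyMeasurable, ?_⟩
  rw [hasFiniteIntegral_iff_ofReal (Filter.Eventually.of_forall complexGaussianPDF_nonneg)]
  have h := measure_univ (μ := complexGaussian)
  rw [complexGaussian_eq_withDensity, withDensity_apply _ MeasurableSet.univ,
    setLIntegral_univ] at h
  rw [h]; exact ENNReal.one_lt_top

/-- The squared Euclidean norm, written as a sum because `ι → ℂ` carries the sup norm. -/
noncomputable def energy {ι : Type*} [Fintype ι] (y : ι → ℂ) : ℝ := ∑ i, ‖y i‖ ^ 2

@[fun_prop]
lemma measurable_energy {ι : Type*} [Fintype ι] : Measurable (energy (ι := ι)) := by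
  unfold energy; fun_prop

lemma lintegral_comp_mulVec {ι : Type*} [Fintype ι] [DecidableEq ι] {F : Matrix ι ι ℂ}
    (hF : IsUnit F.det) {g : (ι → ℂ) → ℝ≥0∞} (hg : Measurable g) :
    ENNReal.ofReal (Complex.normSq F.det) * ∫⁻ y, g (F *ᵥ y) = ∫⁻ y, g y := by
  let T : (ι → ℂ) →ₗ[ℝ] (ι → ℂ) := (Matrix.toLin' F).restrictScalars ℝ
  have hpos : 0 < Complex.normSq F.det := Complex.normSq_pos.2 hF.ne_zero
  have hT : LinearMap.det T = Complex.normSq F.det := by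
    rw [LinearMap.det_restrictScalars, LinearMap.det_toLin', Algebra.norm_complex_apply]
  have hmap : ∫⁻ y, g (F *ᵥ y) = ∫⁻ y, g y ∂(volume.map T) :=
    (lintegral_map hg T.continuous_of_finiteDimensional.measurable).symm
  rw [hmap, Measure.map_linearMap_addHaar_eq_smul_addHaar _ (hT ▸ hpos.ne'),
    lintegral_smul_measure, hT, abs_of_pos (inv_pos.2 hpos), smul_eq_mul, ← mul_assoc,
    ← ENNReal.ofReal_mul hpos.le, mul_inv_cancel₀ hpos.ne', ENNReal.ofReal_one, one_mul]

variable {r : ℕ}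

/-- The density of the law `CN(0, I)`. -/
noncomputable def noisePDF (v : Fin r → ℂ) : ℝ≥0∞ :=
  ENNReal.ofReal ((Real.pi ^ r)⁻¹ * Real.exp (-energy v))

@[fun_prop]
lemma measurable_noisePDF : Measurable (noisePDF (r := r)) := by
  unfold noisePDF; fun_prop

lemma noiseLaw_eq_withDensity : noiseLaw r = volume.withDensity noisePDF := by
  have hpdf : noisePDF (r := r) =
      fun v => ENNReal.ofReal (∏ i, complexGaussianPDF (v i)) := by
    funext v
    simp only [noisePDF, energy, complexGaussianPDF, Finset.prod_mul_distrib, Finset.prod_const,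
      Finset.card_univ, Fintype.card_fin, inv_pow, ← Real.exp_sum, Finset.sum_neg_distrib]
  rw [hpdf, noiseLaw, complexGaussian_eq_withDensity]
  exact pi_withDensity_ofReal integrable_complexGaussianPDF complexGaussianPDF_nonneg

/-- The density with respect to `CN(0, I)` of the law of `F⁻¹ (a + v)`, `v ∼ CN(0, I)`. -/
noncomputable def affineDensity (F : Matrix (Fin r) (Fin r) ℂ) (a y : Fin r → ℂ) : ℝ :=
  Complex.normSq F.det * Real.exp (energy y - energy (F *ᵥ y - a))

lemma affineDensity_pos {F : Matrix (Fin r) (Fin r) ℂ} (hF : IsUnit F.det) (a y : Fin r → ℂ) :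
    0 < affineDensity F a y :=
  mul_pos (Complex.normSq_pos.2 hF.ne_zero) (Real.exp_pos _)

lemma log_affineDensity {F : Matrix (Fin r) (Fin r) ℂ} (hF : IsUnit F.det) (a y : Fin r → ℂ) :
    Real.log (affineDensity F a y) =
      Real.log (Complex.normSq F.det) + (energy y - energy (F *ᵥ y - a)) := by
  rw [affineDensity, Real.log_mul (Complex.normSq_pos.2 hF.ne_zero).ne' (Real.exp_pos _).ne',
    Real.log_exp]

lemma noisePDF_mul_affineDensity (F : Matrix (Fin r) (Fin r) ℂ) (a y : Fin r → ℂ) :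
    noisePDF y * ENNReal.ofReal (affineDensity F a y) =
      ENNReal.ofReal (Complex.normSq F.det) * noisePDF (F *ᵥ y - a) := by
  rw [noisePDF, noisePDF, ← ENNReal.ofReal_mul (by positivity),
    ← ENNReal.ofReal_mul (Complex.normSq_nonneg _), affineDensity, sub_eq_add_neg, Real.exp_add,
    Real.exp_neg (energy y)]
  congr 1
  field_simp

lemma noiseLaw_map_affine {F : Matrix (Fin r) (Fin r) ℂ} (hF : IsUnit F.det) (a : Fin r → ℂ) :
    (noiseLaw r).map (fun v => F⁻¹ *ᵥ (a + v)) =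
      (noiseLaw r).withDensity fun y => ENNReal.ofReal (affineDensity F a y) := by
  have hdens : Measurable fun y => ENNReal.ofReal (affineDensity F a y) := by
    unfold affineDensity; fun_prop
  refine Measure.ext_of_lintegral _ fun g hg => ?_
  have : Measurable fun v => noisePDF v * g (F⁻¹ *ᵥ (a + v)) := by fun_prop
  calc ∫⁻ y, g y ∂(noiseLaw r).map (fun v => F⁻¹ *ᵥ (a + v))
      = ∫⁻ v, noisePDF v * g (F⁻¹ *ᵥ (a + v)) := by
        rw [lintegral_map hg (by fun_prop), noiseLaw_eq_withDensity,
          lintegral_withDensity_eq_lintegral_mul _ measurable_noisePDF (by fun_prop)]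
        rfl
    _ = ∫⁻ v, noisePDF (v - a) * g (F⁻¹ *ᵥ v) := by
        rw [← lintegral_sub_right_eq_self _ a]
        simp only [add_sub_cancel]
    _ = ENNReal.ofReal (Complex.normSq F.det) * ∫⁻ y, noisePDF (F *ᵥ y - a) * g y := by
        rw [← lintegral_comp_mulVec hF (by fun_prop)]
        simp only [mulVec_mulVec, nonsing_inv_mul F hF, one_mulVec]
    _ = ∫⁻ y, g y ∂(noiseLaw r).withDensity fun y => ENNReal.ofReal (affineDensity F a y) := by
        rw [lintegral_withDensity_eq_lintegral_mul _ hdens hg, noiseLaw_eq_withDensity,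
          lintegral_withDensity_eq_lintegral_mul _ measurable_noisePDF (by fun_prop),
          ← lintegral_const_mul _ (by fun_prop)]
        simp only [Pi.mul_apply, ← mul_assoc, noisePDF_mul_affineDensity]

end Gaussian

section SecondMoments

variable {Ω κ : Type*} [MeasurableSpace Ω] {ρ : Measure Ω}

/-- Square integrable, pairwise orthogonal random variables of second moment at most `1`: all that
the capacity bound needs to know about independent centred symbols. -/
structure IsSubOrthonormal (ξ : κ → Ω → ℂ) (ρ : Measure Ω) : Prop where
  memLp : ∀ k, MemLp (ξ k) 2 ρ
  integral_star_mul : ∀ k l, k ≠ l → ∫ ω, star (ξ k ω) * ξ l ω ∂ρ = 0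
  integral_norm_sq_le : ∀ k, ∫ ω, ‖ξ k ω‖ ^ 2 ∂ρ ≤ 1

lemma isSubOrthonormal_of_iIndepFun {ξ : κ → Ω → ℂ} (hξ : ∀ k, MemLp (ξ k) 2 ρ)
    (hind : iIndepFun ξ ρ) (hmean : ∀ k, ∫ ω, ξ k ω ∂ρ = 0)
    (hsq : ∀ k, ∫ ω, ‖ξ k ω‖ ^ 2 ∂ρ ≤ 1) : IsSubOrthonormal ξ ρ where
  memLp := hξ
  integral_norm_sq_le := hsq
  integral_star_mul k l hkl := by
    have h := ((hind.indepFun hkl).comp continuous_star.measurable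
      measurable_id).integral_fun_mul_eq_mul_integral (hξ k).star.aestronglyMeasurable
      (hξ l).aestronglyMeasurable
    simp only [Function.comp_apply, id] at h
    rw [h, hmean l, mul_zero]

lemma IsSubOrthonormal.sumElim_prod {κ' Ω' : Type*} [MeasurableSpace Ω'] {ρ' : Measure Ω'}
    [IsProbabilityMeasure ρ] [IsProbabilityMeasure ρ'] {ξ : κ → Ω → ℂ} {η : κ' → Ω' → ℂ}
    (hξ : IsSubOrthonormal ξ ρ) (hη : IsSubOrthonormal η ρ') (hmean : ∀ k, ∫ ω, η k ω ∂ρ' = 0) :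
    IsSubOrthonormal
      (Sum.elim (fun k (p : Ω × Ω') => ξ k p.1) fun k p => η k p.2) (ρ.prod ρ') where
  memLp := by
    rintro (k | k)
    · exact (hξ.memLp k).comp_measurePreserving measurePreserving_fst
    · exact (hη.memLp k).comp_measurePreserving measurePreserving_snd
  integral_star_mul := by
    rintro (k | k) (l | l) hkl <;> simp only [Sum.elim_inl, Sum.elim_inr]
    · rw [integral_fun_fst (f := fun ω => star (ξ k ω) * ξ l ω),
        hξ.integral_star_mul k l (by simpa using hkl), smul_zero]
    · rw [integral_prod_mul (fun ω => star (ξ k ω)), hmean, mul_zero]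
    · simp only [mul_comm (star _)]
      rw [integral_prod_mul _ (fun ω => star (η k ω))]
      have h : ∫ ω, star (η k ω) ∂ρ' = star (∫ ω, η k ω ∂ρ') := integral_conj
      rw [h, hmean, star_zero, mul_zero]
    · rw [integral_fun_snd (f := fun ω => star (η k ω) * η l ω),
        hη.integral_star_mul k l (by simpa using hkl), smul_zero]
  integral_norm_sq_le := by
    rintro (k | k) <;> simp only [Sum.elim_inl, Sum.elim_inr]
    · rw [integral_fun_fst (f := fun ω => ‖ξ k ω‖ ^ 2), probReal_univ, one_smul]
      exact hξ.integral_norm_sq_le k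
    · rw [integral_fun_snd (f := fun ω => ‖η k ω‖ ^ 2), probReal_univ, one_smul]
      exact hη.integral_norm_sq_le k

variable [Fintype κ]

lemma norm_sum_sq_eq (a z : κ → ℂ) :
    ‖∑ k, a k * z k‖ ^ 2 = ∑ k, ∑ l, (star (a k) * a l * (star (z k) * z l)).re := by
  have h := congrArg Complex.re (Complex.conj_mul' (∑ k, a k * z k))
  rw [← Complex.ofReal_pow, Complex.ofReal_re] at h
  rw [← h, map_sum, Finset.sum_mul_sum]
  simp only [Complex.re_sum, map_mul, Complex.star_def]
  exact Finset.sum_congr rfl fun k _ => Finset.sum_congr rfl fun l _ => by congr 1; ring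

variable {ξ : κ → Ω → ℂ}

lemma IsSubOrthonormal.integral_norm_sum_sq_le (hξ : IsSubOrthonormal ξ ρ) (a : κ → ℂ) :
    ∫ ω, ‖∑ k, a k * ξ k ω‖ ^ 2 ∂ρ ≤ ∑ k, ‖a k‖ ^ 2 := by
  have hint (k l : κ) : Integrable (fun ω => star (a k) * a l * (star (ξ k ω) * ξ l ω)) ρ :=
    ((hξ.memLp k).star.integrable_mul (hξ.memLp l)).const_mul _
  have hint' (k l : κ) :
      Integrable (fun ω => (star (a k) * a l * (star (ξ k ω) * ξ l ω)).re) ρ := (hint k l).re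
  have hre (k l : κ) : ∫ ω, (star (a k) * a l * (star (ξ k ω) * ξ l ω)).re ∂ρ =
      (star (a k) * a l * ∫ ω, star (ξ k ω) * ξ l ω ∂ρ).re := by
    rw [← integral_const_mul]
    exact integral_re (hint k l)
  have hdiag (k : κ) : (star (a k) * a k * ∫ ω, star (ξ k ω) * ξ k ω ∂ρ).re =
      ‖a k‖ ^ 2 * ∫ ω, ‖ξ k ω‖ ^ 2 ∂ρ := by
    simp only [Complex.star_def, Complex.conj_mul', ← Complex.ofReal_pow]
    rw [integral_complex_ofReal, ← Complex.ofReal_mul, Complex.ofReal_re]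
  simp only [norm_sum_sq_eq]
  rw [integral_finsetSum _ fun k _ => integrable_finsetSum _ fun l _ => hint' k l]
  refine Finset.sum_le_sum fun k _ => ?_
  rw [integral_finsetSum _ fun l _ => hint' k l,
    Finset.sum_eq_single_of_mem k (Finset.mem_univ k) fun l _ hlk => by
      rw [hre, hξ.integral_star_mul k l hlk.symm, mul_zero, Complex.zero_re], hre, hdiag]
  exact mul_le_of_le_one_right (sq_nonneg _) (hξ.integral_norm_sq_le k)

lemma re_trace_mul_conjTranspose {m : Type*} [Fintype m] (B : Matrix m κ ℂ) :
    (B * Bᴴ).trace.re = ∑ i, ∑ k, ‖B i k‖ ^ 2 := by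
  simp only [trace, diag_apply, mul_apply, conjTranspose_apply, Complex.star_def,
    Complex.mul_conj', Complex.re_sum, ← Complex.ofReal_pow, Complex.ofReal_re]

variable {m : Type*}

lemma integrable_norm_mulVec_sq (hξ : ∀ k, MemLp (ξ k) 2 ρ) (B : Matrix m κ ℂ) (i : m) :
    Integrable (fun ω => ‖(B *ᵥ fun k => ξ k ω) i‖ ^ 2) ρ :=
  (memLp_finsetSum _ fun k _ => (hξ k).const_mul (B i k)).integrable_norm_pow two_ne_zero

variable [Fintype m]

lemma integrable_energy_mulVec (hξ : ∀ k, MemLp (ξ k) 2 ρ) (B : Matrix m κ ℂ) :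
    Integrable (fun ω => energy (B *ᵥ fun k => ξ k ω)) ρ :=
  integrable_finsetSum _ fun i _ => integrable_norm_mulVec_sq hξ B i

lemma IsSubOrthonormal.integral_energy_mulVec_le (hξ : IsSubOrthonormal ξ ρ) (B : Matrix m κ ℂ) :
    ∫ ω, energy (B *ᵥ fun k => ξ k ω) ∂ρ ≤ (B * Bᴴ).trace.re := by
  rw [re_trace_mul_conjTranspose]
  unfold energy
  rw [integral_finsetSum _ fun i _ => integrable_norm_mulVec_sq hξ.memLp B i]
  exact Finset.sum_le_sum fun i _ => hξ.integral_norm_sum_sq_le (B i)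

end SecondMoments

section NoiseMoments

lemma integral_complexGaussian_eq {E : Type*} [NormedAddCommGroup E] [NormedSpace ℝ E]
    (f : ℂ → E) : ∫ z, f z ∂complexGaussian =
      ∫ p, f (p.1 + p.2 * Complex.I) ∂(gaussianReal 0 (1 / 2)).prod (gaussianReal 0 (1 / 2)) := by
  rw [complexGaussian_eq_map, integral_map_equiv]
  simp only [Complex.measurableEquivRealProd_symm_apply, Complex.mk_eq_add_mul_I]

lemma memLp_fst_add_snd_mul_I :
    MemLp (fun p : ℝ × ℝ => (p.1 + p.2 * Complex.I : ℂ)) 2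
      ((gaussianReal 0 (1 / 2)).prod (gaussianReal 0 (1 / 2))) := by
  have hG : MemLp (fun x : ℝ => (x : ℂ)) 2 (gaussianReal 0 (1 / 2)) :=
    MemLp.ofReal (memLp_id_gaussianReal' 2 (by norm_num))
  have hre : MemLp (fun p : ℝ × ℝ => (p.1 : ℂ)) 2
      ((gaussianReal 0 (1 / 2)).prod (gaussianReal 0 (1 / 2))) :=
    hG.comp_measurePreserving measurePreserving_fst
  have him : MemLp (fun p : ℝ × ℝ => (p.2 : ℂ)) 2
      ((gaussianReal 0 (1 / 2)).prod (gaussianReal 0 (1 / 2))) :=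
    hG.comp_measurePreserving measurePreserving_snd
  exact hre.add (him.mul_const Complex.I)

lemma memLp_complexGaussian : MemLp (fun z => z) 2 complexGaussian := by
  rw [complexGaussian_eq_map, memLp_map_measure_iff (by fun_prop) (by fun_prop)]
  simpa only [Function.comp_def, Complex.measurableEquivRealProd_symm_apply,
    Complex.mk_eq_add_mul_I] using memLp_fst_add_snd_mul_I

lemma integral_complexGaussian : ∫ z, z ∂complexGaussian = 0 := by
  have hG : Integrable (fun x : ℝ => x) (gaussianReal 0 (1 / 2)) :=
    (memLp_id_gaussianReal' 2 (by norm_num)).integrable (by norm_num)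
  have hmean : ∫ x : ℝ, (x : ℂ) ∂gaussianReal 0 (1 / 2) = 0 := by
    rw [integral_complex_ofReal, integral_id_gaussianReal, Complex.ofReal_zero]
  rw [integral_complexGaussian_eq, integral_add (hG.comp_fst _).ofReal
    ((hG.comp_snd _).ofReal.mul_const _), integral_mul_const,
    integral_fun_fst (f := fun x : ℝ => (x : ℂ)), integral_fun_snd (f := fun x : ℝ => (x : ℂ)),
    hmean]
  simp only [smul_zero, zero_mul, add_zero]

lemma integral_sq_gaussianReal : ∫ x, x ^ 2 ∂gaussianReal 0 (1 / 2) = 1 / 2 := by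
  have h := variance_fun_id_gaussianReal (μ := 0) (v := 1 / 2)
  rw [variance_eq_integral measurable_id'.aemeasurable] at h
  simpa using h

lemma integral_norm_sq_complexGaussian : ∫ z, ‖z‖ ^ 2 ∂complexGaussian = 1 := by
  have hG : Integrable (fun x : ℝ => x ^ 2) (gaussianReal 0 (1 / 2)) :=
    (memLp_id_gaussianReal' 2 (by norm_num)).integrable_sq
  rw [integral_complexGaussian_eq]
  simp only [← Complex.mk_eq_add_mul_I, Complex.sq_norm, Complex.normSq_mk, ← sq]
  rw [integral_add (hG.comp_fst _) (hG.comp_snd _), integral_fun_fst (f := fun x : ℝ => x ^ 2),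
    integral_fun_snd (f := fun x : ℝ => x ^ 2), integral_sq_gaussianReal]
  norm_num

variable {r : ℕ}

lemma measurePreserving_noiseLaw_apply (i : Fin r) :
    MeasurePreserving (fun v => v i) (noiseLaw r) complexGaussian :=
  measurePreserving_eval (fun _ => complexGaussian) i

lemma integral_noiseLaw_apply (i : Fin r) : ∫ v, v i ∂noiseLaw r = 0 :=
  (integral_comp_eval (μ := fun _ => complexGaussian)
    measurable_id.aestronglyMeasurable).trans integral_complexGaussian

lemma integral_noiseLaw_norm_sq_apply (i : Fin r) : ∫ v, ‖v i‖ ^ 2 ∂noiseLaw r = 1 :=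
  (integral_comp_eval (μ := fun _ => complexGaussian) (f := fun z : ℂ => ‖z‖ ^ 2)
    (by fun_prop)).trans integral_norm_sq_complexGaussian

lemma memLp_noiseLaw_apply (i : Fin r) : MemLp (fun v => v i) 2 (noiseLaw r) :=
  memLp_complexGaussian.comp_measurePreserving (measurePreserving_noiseLaw_apply i)

lemma isSubOrthonormal_noiseLaw :
    IsSubOrthonormal (fun (i : Fin r) v => v i) (noiseLaw r) :=
  isSubOrthonormal_of_iIndepFun memLp_noiseLaw_apply
    (iIndepFun_pi (X := fun (_ : Fin r) z => z) fun _ => measurable_id.aemeasurable)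
    integral_noiseLaw_apply fun i => (integral_noiseLaw_norm_sq_apply i).le

lemma integrable_energy_noiseLaw : Integrable energy (noiseLaw r) :=
  integrable_finsetSum _ fun i _ => (memLp_noiseLaw_apply i).integrable_norm_pow two_ne_zero

lemma integral_energy_noiseLaw : ∫ v, energy v ∂noiseLaw r = r := by
  unfold energy
  rw [integral_finsetSum _ fun i _ => (memLp_noiseLaw_apply i).integrable_norm_pow two_ne_zero]
  simp only [integral_noiseLaw_norm_sq_apply, Finset.sum_const, Finset.card_univ,
    Fintype.card_fin, nsmul_eq_mul, mul_one]

end NoiseMoments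

section Channel

open InformationTheory

variable {r : ℕ} {𝓧 κ : Type*} [MeasurableSpace 𝓧] {μ : Measure 𝓧} [IsProbabilityMeasure μ]

section Whitening

variable {F : Matrix (Fin r) (Fin r) ℂ}

lemma klDiv_whitened_le (hF : IsUnit F.det) {a : 𝓧 → Fin r → ℂ} (ha : Measurable a)
    (hint : Integrable (fun p => energy (F⁻¹ *ᵥ (a p.1 + p.2))) (μ.prod (noiseLaw r)))
    (hle : ∫ p, energy (F⁻¹ *ᵥ (a p.1 + p.2)) ∂μ.prod (noiseLaw r) ≤ r) :
    klDiv ((μ.prod (noiseLaw r)).map fun p => (p.1, F⁻¹ *ᵥ (a p.1 + p.2)))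
        (μ.prod (noiseLaw r)) ≤ ENNReal.ofReal (Real.log (Complex.normSq F.det)) := by
  have hT : Measurable fun p : 𝓧 × (Fin r → ℂ) => (p.1, F⁻¹ *ᵥ (a p.1 + p.2)) := by fun_prop
  have hf : Measurable fun p : 𝓧 × (Fin r → ℂ) => affineDensity F (a p.1) p.2 := by
    unfold affineDensity; fun_prop
  have hlog (p : 𝓧 × (Fin r → ℂ)) :
      Real.log (affineDensity F (a p.1) (F⁻¹ *ᵥ (a p.1 + p.2))) =
        Real.log (Complex.normSq F.det) + (energy (F⁻¹ *ᵥ (a p.1 + p.2)) - energy p.2) := by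
    rw [log_affineDensity hF, mulVec_mulVec, mul_nonsing_inv F hF, one_mulVec, add_sub_cancel_left]
  have hnoise : Integrable (fun p => energy p.2) (μ.prod (noiseLaw r)) :=
    integrable_energy_noiseLaw.comp_snd μ
  have hP : (μ.prod (noiseLaw r)).map (fun p => (p.1, F⁻¹ *ᵥ (a p.1 + p.2))) =
      (μ.prod (noiseLaw r)).withDensity fun p =>
        ENNReal.ofReal (affineDensity F (a p.1) p.2) :=
    map_prodMk_eq_withDensity (by fun_prop) hf.ennreal_ofReal
      fun x => noiseLaw_map_affine hF (a x)
  have hprob := Measure.isProbabilityMeasure_map (μ := μ.prod (noiseLaw r)) hT.aemeasurable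
  rw [hP] at hprob ⊢
  rw [klDiv_withDensity_ofReal hf (fun p => affineDensity_pos hF _ _), ← hP,
    integral_map hT.aemeasurable hf.log.aestronglyMeasurable]
  · have hdiff : Integrable (fun p => energy (F⁻¹ *ᵥ (a p.1 + p.2)) - energy p.2)
        (μ.prod (noiseLaw r)) := hint.sub hnoise
    simp only [hlog]
    rw [integral_add (integrable_const _) hdiff, integral_sub hint hnoise,
      integral_fun_snd (f := energy), integral_energy_noiseLaw]
    simp only [integral_const, probReal_univ, one_smul]
    exact ENNReal.ofReal_le_ofReal (by linarith)
  · rw [← hP, integrable_map_measure hf.log.aestronglyMeasurable hT.aemeasurable]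
    simp only [Function.comp_def, hlog]
    exact (integrable_const _).add (hint.sub hnoise)

variable [Fintype κ] {B : Matrix (Fin r) κ ℂ} {ξ : κ → 𝓧 → ℂ}

lemma inv_mul_mul_conjTranspose_inv (hF : IsUnit F.det) : F⁻¹ * (F * Fᴴ) * F⁻¹ᴴ = 1 := by
  rw [← Matrix.mul_assoc, nonsing_inv_mul F hF, Matrix.one_mul, ← conjTranspose_mul,
    nonsing_inv_mul F hF, conjTranspose_one]

omit [MeasurableSpace 𝓧] in
lemma inv_mulVec_add_eq_fromCols_mulVec (p : 𝓧 × (Fin r → ℂ)) :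
    F⁻¹ *ᵥ (B *ᵥ (fun k => ξ k p.1) + p.2) = (F⁻¹ * fromCols B 1) *ᵥ fun k =>
      Sum.elim (fun k (p : 𝓧 × (Fin r → ℂ)) => ξ k p.1) (fun i p => p.2 i) k p := by
  have hsplit : (fun k => Sum.elim (fun k (p : 𝓧 × (Fin r → ℂ)) => ξ k p.1) (fun i p => p.2 i) k p)
      = Sum.elim (fun k => ξ k p.1) p.2 := by
    ext (k | i) <;> rfl
  rw [hsplit, ← mulVec_mulVec, fromCols_mulVec_sumElim, one_mulVec]

lemma integrable_energy_whitened (F : Matrix (Fin r) (Fin r) ℂ) (B : Matrix (Fin r) κ ℂ)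
    (hξ : IsSubOrthonormal ξ μ) :
    Integrable (fun p => energy (F⁻¹ *ᵥ (B *ᵥ (fun k => ξ k p.1) + p.2)))
      (μ.prod (noiseLaw r)) := by
  simp only [inv_mulVec_add_eq_fromCols_mulVec]
  exact integrable_energy_mulVec
    (hξ.sumElim_prod isSubOrthonormal_noiseLaw integral_noiseLaw_apply).memLp _

lemma integral_energy_whitened_le (hF : IsUnit F.det) (hBF : 1 + B * Bᴴ = F * Fᴴ)
    (hξ : IsSubOrthonormal ξ μ) :
    ∫ p, energy (F⁻¹ *ᵥ (B *ᵥ (fun k => ξ k p.1) + p.2)) ∂μ.prod (noiseLaw r) ≤ r := by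
  have hone : F⁻¹ * fromCols B (1 : Matrix (Fin r) (Fin r) ℂ) *
      (F⁻¹ * fromCols B (1 : Matrix (Fin r) (Fin r) ℂ))ᴴ = 1 := by
    rw [conjTranspose_mul, ← Matrix.mul_assoc, Matrix.mul_assoc F⁻¹,
      conjTranspose_fromCols_eq_fromRows_conjTranspose, fromCols_mul_fromRows, conjTranspose_one,
      Matrix.one_mul, add_comm, hBF, inv_mul_mul_conjTranspose_inv hF]
  simp only [inv_mulVec_add_eq_fromCols_mulVec]
  refine ((hξ.sumElim_prod isSubOrthonormal_noiseLaw
    integral_noiseLaw_apply).integral_energy_mulVec_le _).trans_eq ?_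
  rw [hone, trace_one, Fintype.card_fin, Complex.natCast_re]

end Whitening

variable [Fintype κ] {B : Matrix (Fin r) κ ℂ} {ξ : κ → 𝓧 → ℂ} {m : 𝓧 → Fin r → ℂ}
  {F : Matrix (Fin r) (Fin r) ℂ}

lemma klDiv_channel_le (hm : Measurable m) (hξm : ∀ k, Measurable (ξ k))
    (hξ : IsSubOrthonormal ξ μ) (hF : IsUnit F.det) (hBF : 1 + B * Bᴴ = F * Fᴴ) :
    klDiv ((μ.prod (noiseLaw r)).map fun p => (p.1, m p.1 + B *ᵥ (fun k => ξ k p.1) + p.2))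
        ((μ.prod (noiseLaw r)).map fun p => (p.1, m p.1 + F *ᵥ p.2)) ≤
      ENNReal.ofReal (Real.log (1 + B * Bᴴ).det.re) := by
  have ha : Measurable fun x => B *ᵥ (fun k => ξ k x) := by fun_prop
  have hdet : Complex.normSq F.det = (1 + B * Bᴴ).det.re := by
    rw [hBF, det_mul, det_conjTranspose, Complex.star_def, Complex.mul_conj, Complex.ofReal_re]
  have hcolor : Measurable fun p : 𝓧 × (Fin r → ℂ) => (p.1, m p.1 + F *ᵥ p.2) := by fun_prop
  have hmap : (μ.prod (noiseLaw r)).map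
        (fun p => (p.1, m p.1 + B *ᵥ (fun k => ξ k p.1) + p.2)) =
      ((μ.prod (noiseLaw r)).map fun p => (p.1, F⁻¹ *ᵥ (B *ᵥ (fun k => ξ k p.1) + p.2))).map
        fun p => (p.1, m p.1 + F *ᵥ p.2) := by
    rw [Measure.map_map hcolor (by fun_prop)]
    simp only [Function.comp_def, mulVec_mulVec, mul_nonsing_inv F hF, one_mulVec, add_assoc]
  rw [hmap, ← hdet]
  exact (klDiv_map_le _ _ hcolor).trans (klDiv_whitened_le hF ha
    (integrable_energy_whitened F B hξ) (integral_energy_whitened_le hF hBF hξ))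

open scoped ComplexOrder in
lemma exists_one_add_mul_conjTranspose_eq {m : Type*} [Fintype m] [DecidableEq m]
    (B : Matrix m κ ℂ) : ∃ F : Matrix m m ℂ, IsUnit F.det ∧ 1 + B * Bᴴ = F * Fᴴ := by
  have hpos : (1 + B * Bᴴ).PosDef :=
    PosDef.one.add_posSemidef (posSemidef_self_mul_conjTranspose B)
  obtain ⟨F, hF⟩ := exists_eq_mul_conjTranspose hpos.posSemidef
  have hdet := hpos.det_pos.ne'
  rw [hF, det_mul] at hdet
  exact ⟨F, (left_ne_zero_of_mul hdet).isUnit, hF⟩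

theorem mutualInfo_channel_le [StandardBorelSpace 𝓧] (hm : Measurable m)
    (hξm : ∀ k, Measurable (ξ k)) (hξ : IsSubOrthonormal ξ μ) {M : NNReal}
    (hM : ∀ᵐ x ∂μ, 1 ≤ M * μ {x' | m x' = m x}) :
    mutualInfo (μ.prod (noiseLaw r)) (fun p => p.1)
        (fun p => m p.1 + B *ᵥ (fun k => ξ k p.1) + p.2) ≤
      ENNReal.ofReal (Real.log M) + ENNReal.ofReal (Real.log (1 + B * Bᴴ).det.re) := by
  obtain ⟨F, hF, hBF⟩ := exists_one_add_mul_conjTranspose_eq B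
  have hY : Measurable fun p : 𝓧 × (Fin r → ℂ) => m p.1 + B *ᵥ (fun k => ξ k p.1) + p.2 := by
    fun_prop
  have hΨ : Measurable fun p : 𝓧 × (Fin r → ℂ) => m p.1 + F *ᵥ p.2 := by fun_prop
  set ν := (μ.prod (noiseLaw r)).map fun p => m p.1 + F *ᵥ p.2
  have hν : IsProbabilityMeasure ν := Measure.isProbabilityMeasure_map hΨ.aemeasurable
  have hdom : (μ.prod (noiseLaw r)).map (fun p => (p.1, m p.1 + F *ᵥ p.2)) ≤ M • μ.prod ν :=
    map_prodMk_le_smul_prod (Ψ := fun x v => m x + F *ᵥ v) (T := m) hΨ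
      (fun x x' h => by rw [h]) hM
  have hP := Measure.isProbabilityMeasure_map (μ := μ.prod (noiseLaw r))
    (measurable_fst.prodMk hY).aemeasurable
  have hQ := Measure.isProbabilityMeasure_map (μ := μ.prod (noiseLaw r))
    (measurable_fst.prodMk hΨ).aemeasurable
  have hfst : (μ.prod (noiseLaw r)).map (fun p => p.1) = μ := measurePreserving_fst.map_eq
  refine (mutualInfo_le_klDiv_prod _ measurable_fst hY ν).trans ?_
  rw [hfst]
  refine (klDiv_le_log_add_klDiv hdom).trans ?_
  gcongr
  exact klDiv_channel_le hm hξm hξ hF hBF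

end Channel

section RankFunction

variable {E : Type*}

lemma IsRankFunction.of_union_add_inter_le [DecidableEq E] {f : Finset E → ℝ} (hempty : f ∅ = 0)
    (hmono : Monotone f) (hsub : ∀ A B, f (A ∪ B) + f (A ∩ B) ≤ f A + f B) :
    IsRankFunction f where
  nonneg A := hempty ▸ hmono (Finset.empty_subset A)
  normalized := hempty
  monotone A B hAB := hmono hAB
  submodular A B hAB e := by
    have hunion : A ∪ {e} ∪ B = B ∪ {e} := by grind
    have hinter : f A ≤ f ((A ∪ {e}) ∩ B) := hmono (by grind)
    have hmarginal : f (B ∪ {e}) - f B ≤ f (A ∪ {e}) - f A := by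
      linarith [hunion ▸ hsub (A ∪ {e}) B]
    convert hmarginal

lemma IsRankFunction.sum {ι : Type*} {t : Finset ι} {f : ι → Finset E → ℝ}
    (hf : ∀ i ∈ t, IsRankFunction (f i)) : IsRankFunction fun A => ∑ i ∈ t, f i A where
  nonneg A := Finset.sum_nonneg fun i hi => (hf i hi).nonneg A
  normalized := Finset.sum_eq_zero fun i hi => (hf i hi).normalized
  monotone A B hAB := Finset.sum_le_sum fun i hi => (hf i hi).monotone A B hAB
  submodular A B hAB e := by
    simp only [← Finset.sum_sub_distrib]
    exact Finset.sum_le_sum fun i hi => (hf i hi).submodular A B hAB e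

variable [DecidableEq E] {f : Finset E → ℝ}

/-- The convolution `A ↦ min_{R ⊆ A} (f (A \ R) + ∑ e ∈ R, w e)` of a set function with an
additive one. The bound `gRB` is the convolution of `logDet` with the weights `Nt log S_e`. -/
noncomputable def minConv (f : Finset E → ℝ) (w : E → ℝ) (A : Finset E) : ℝ :=
  A.powerset.inf' ⟨∅, Finset.empty_mem_powerset A⟩ fun R => f (A \ R) + ∑ e ∈ R, w e

lemma minConv_le (f : Finset E → ℝ) (w : E → ℝ) {A S : Finset E} (hS : S ⊆ A) :
    minConv f w A ≤ f S + (∑ e ∈ A, w e - ∑ e ∈ S, w e) := by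
  have hle := Finset.inf'_le (fun R => f (A \ R) + ∑ e ∈ R, w e)
    (Finset.mem_powerset.2 (Finset.sdiff_subset : A \ S ⊆ A))
  rwa [Finset.sdiff_sdiff_eq_self hS, Finset.sum_sdiff_eq_sub hS] at hle

lemma exists_minConv_eq (f : Finset E → ℝ) (w : E → ℝ) (A : Finset E) :
    ∃ S ⊆ A, minConv f w A = f S + (∑ e ∈ A, w e - ∑ e ∈ S, w e) := by
  obtain ⟨R, hR, hmin⟩ := Finset.exists_mem_eq_inf' (⟨∅, Finset.empty_mem_powerset A⟩ :
    A.powerset.Nonempty) (fun R => f (A \ R) + ∑ e ∈ R, w e)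
  refine ⟨A \ R, Finset.sdiff_subset, ?_⟩
  rw [minConv, hmin, Finset.sum_sdiff_eq_sub (Finset.mem_powerset.1 hR), sub_sub_cancel]

lemma minConv_union_add_inter_le (w : E → ℝ)
    (hf : ∀ S T, f (S ∪ T) + f (S ∩ T) ≤ f S + f T) (A B : Finset E) :
    minConv f w (A ∪ B) + minConv f w (A ∩ B) ≤ minConv f w A + minConv f w B := by
  obtain ⟨S, hSA, hS⟩ := exists_minConv_eq f w A
  obtain ⟨T, hTB, hT⟩ := exists_minConv_eq f w B
  linarith [minConv_le f w (Finset.union_subset_union hSA hTB),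
    minConv_le f w (Finset.inter_subset_inter hSA hTB), hf S T,
    Finset.sum_union_inter (s₁ := A) (s₂ := B) (f := w),
    Finset.sum_union_inter (s₁ := S) (s₂ := T) (f := w)]

lemma monotone_minConv {w : E → ℝ} (hf : Monotone f) (hw : ∀ e, 0 ≤ w e) :
    Monotone (minConv f w) := by
  intro A B hAB
  obtain ⟨T, hTB, hT⟩ := exists_minConv_eq f w B
  have hweight : ∑ e ∈ T ∪ A, w e ≤ ∑ e ∈ B, w e :=
    Finset.sum_le_sum_of_subset_of_nonneg (Finset.union_subset hTB hAB) fun e _ _ => hw e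
  linarith [minConv_le f w (Finset.inter_subset_right : T ∩ A ⊆ A),
    hf (Finset.inter_subset_left : T ∩ A ⊆ T),
    Finset.sum_union_inter (s₁ := T) (s₂ := A) (f := w)]

lemma minConv_empty (w : E → ℝ) (hf : f ∅ = 0) : minConv f w ∅ = 0 := by
  simp [minConv, hf]

lemma isRankFunction_minConv {w : E → ℝ} (hempty : f ∅ = 0) (hmono : Monotone f)
    (hsub : ∀ A B, f (A ∪ B) + f (A ∩ B) ≤ f A + f B) (hw : ∀ e, 0 ≤ w e) :
    IsRankFunction (minConv f w) :=
  .of_union_add_inter_le (minConv_empty w hempty) (monotone_minConv hmono hw)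
    (minConv_union_add_inter_le w hsub)

end RankFunction

section System

open scoped ComplexOrder MatrixOrder

variable {K N Nr Nt : ℕ} (s : System K N Nr Nt)

lemma System.alloc_nonneg (e : s.Element) (n : Fin N) : 0 ≤ s.alloc e n := Nat.cast_nonneg _

lemma System.psd_nonneg {s : System K N Nr Nt} (hbudget : ∀ k, 0 ≤ s.budget k) (e : s.Element) :
    0 ≤ s.psd e :=
  div_nonneg (hbudget _) (Finset.sum_nonneg fun n _ => s.alloc_nonneg e n)

/-- The signal covariance `∑_{e ∈ A} p_e c_e(n) H_e W_e (H_e W_e)†`, the matrix inside `logDet`. -/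
noncomputable def System.signalCov (n : Fin N) (A : Finset s.Element) :
    Matrix (Fin Nr) (Fin Nr) ℂ :=
  ∑ e ∈ A, ((s.psd e * s.alloc e n : ℝ) : ℂ) • (s.effChannel n e * (s.effChannel n e)ᴴ)

variable {s}

lemma System.signalCov_posSemidef (hbudget : ∀ k, 0 ≤ s.budget k) (n : Fin N)
    (A : Finset s.Element) : (s.signalCov n A).PosSemidef := by
  refine posSemidef_sum _ fun e _ => (posSemidef_self_mul_conjTranspose _).smul ?_
  exact_mod_cast mul_nonneg (System.psd_nonneg hbudget e) (s.alloc_nonneg e n)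

lemma System.one_add_signalCov_posDef (hbudget : ∀ k, 0 ≤ s.budget k) (n : Fin N)
    (A : Finset s.Element) : (1 + s.signalCov n A).PosDef :=
  PosDef.one.add_posSemidef (signalCov_posSemidef hbudget n A)

lemma System.signalCov_mono (hbudget : ∀ k, 0 ≤ s.budget k) (n : Fin N) :
    Monotone (s.signalCov n) := fun _ _ hAB =>
  Finset.sum_le_sum_of_subset_of_nonneg hAB fun e _ _ => by
    simpa [signalCov] using (signalCov_posSemidef hbudget n {e}).nonneg

lemma System.logDet_empty (n : Fin N) : s.logDet n ∅ = 0 := by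
  simp [System.logDet]

lemma System.monotone_logDet (hbudget : ∀ k, 0 ≤ s.budget k) (n : Fin N) :
    Monotone (s.logDet n) := fun A _ hAB =>
  log_re_det_mono (one_add_signalCov_posDef hbudget n A)
    (add_le_add_right (signalCov_mono hbudget n hAB) 1)

lemma System.logDet_union_add_inter_le [DecidableEq s.Element] (hbudget : ∀ k, 0 ≤ s.budget k)
    (n : Fin N) (A B : Finset s.Element) :
    s.logDet n (A ∪ B) + s.logDet n (A ∩ B) ≤ s.logDet n A + s.logDet n B := by
  have hle : 1 + s.signalCov n (A ∩ B) ≤ 1 + s.signalCov n B :=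
    add_le_add_right (signalCov_mono hbudget n Finset.inter_subset_right) 1
  have hA : s.signalCov n (A ∩ B) + s.signalCov n (A \ B) = s.signalCov n A :=
    Finset.sum_inter_add_sum_sdiff A B _
  have hunion : s.signalCov n B + s.signalCov n (A \ B) = s.signalCov n (A ∪ B) := by
    rw [← Finset.sdiff_union_self_eq_union, add_comm]
    exact (Finset.sum_union Finset.sdiff_disjoint).symm
  have hdet := log_re_det_add_add_le (one_add_signalCov_posDef hbudget n (A ∩ B)) hle
    (signalCov_posSemidef hbudget n (A \ B))
  rwa [add_assoc, hunion, add_assoc, hA] at hdet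

open Classical in
lemma System.isRankFunction_gRB (hbudget : ∀ k, 0 ≤ s.budget k) (n : Fin N) :
    IsRankFunction (s.gRB n) :=
  isRankFunction_minConv (logDet_empty n) (monotone_logDet hbudget n)
    (logDet_union_add_inter_le hbudget n)
    fun e => mul_nonneg (Nat.cast_nonneg _) (Real.log_natCast_nonneg (s.constellation e).card)

lemma System.isRankFunction_g (hbudget : ∀ k, 0 ≤ s.budget k) : IsRankFunction s.g :=
  .sum fun n _ => isRankFunction_gRB hbudget n

end System

section Symbols

lemma integral_norm_sub_integral_sq_le {Ω : Type*} [MeasurableSpace Ω] {ρ : Measure Ω}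
    [IsProbabilityMeasure ρ] {f : Ω → ℂ} (hf : MemLp f 2 ρ) :
    ∫ ω, ‖f ω - ∫ ω', f ω' ∂ρ‖ ^ 2 ∂ρ ≤ ∫ ω, ‖f ω‖ ^ 2 ∂ρ := by
  set m := ∫ ω, f ω ∂ρ with hm
  have hsq : Integrable (fun ω => ‖f ω‖ ^ 2) ρ := hf.integrable_norm_pow two_ne_zero
  have hcross : Integrable (fun ω => inner ℝ (f ω) m) ρ :=
    (hf.integrable one_le_two).inner_const m
  have hmean : ∫ ω, inner ℝ (f ω) m ∂ρ = ‖m‖ ^ 2 := by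
    simp only [real_inner_comm m]
    rw [integral_inner (hf.integrable one_le_two), ← hm, real_inner_self_eq_norm_sq]
  have hdiff : Integrable (fun ω => ‖f ω‖ ^ 2 - 2 * inner ℝ (f ω) m) ρ :=
    hsq.sub (hcross.const_mul 2)
  simp only [norm_sub_sq_real]
  rw [integral_add hdiff (integrable_const _), integral_sub hsq (hcross.const_mul 2),
    integral_const_mul, hmean, integral_const, probReal_univ, one_smul]
  linarith [sq_nonneg ‖m‖]

lemma memLp_uniformOn (C : Finset ℂ) (p : ℝ≥0∞) :
    MemLp (fun z => z) p (uniformOn (C : Set ℂ)) := by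
  obtain ⟨b, hb⟩ := C.finite_toSet.isBounded.exists_norm_le
  refine MemLp.of_bound measurable_id.aestronglyMeasurable b ?_
  filter_upwards [ae_cond_mem C.measurableSet] with z hz using hb z hz

lemma integral_uniformOn (C : Finset ℂ) (f : ℂ → ℝ) :
    ∫ z, f z ∂uniformOn (C : Set ℂ) = (∑ z ∈ C, f z) / (C.card : ℝ) := by
  have hint : IntegrableOn f (C : Set ℂ) Measure.count := by
    rw [← (C : Set ℂ).biUnion_of_singleton]
    simp [integrableOn_finset_iUnion]
  rw [uniformOn, ProbabilityTheory.cond, integral_smul_measure, setIntegral_finset _ hint]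
  simp [div_eq_inv_mul, Measure.real]

lemma uniformOn_singleton_of_mem {C : Finset ℂ} {z : ℂ} (hz : z ∈ C) :
    uniformOn (C : Set ℂ) {z} = (C.card : ℝ≥0∞)⁻¹ := by
  rw [← Finset.coe_singleton, uniformOn_apply_finset, Finset.inter_singleton_of_mem hz,
    Finset.card_singleton, Nat.cast_one, one_div]

lemma pi_setOf_forall_eq {ι : Type*} [Fintype ι] {Ω : ι → Type*} [∀ i, MeasurableSpace (Ω i)]
    (μ : (i : ι) → Measure (Ω i)) [∀ i, IsProbabilityMeasure (μ i)] (p : ι → Prop)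
    [DecidablePred p] (x : (i : ι) → Ω i) :
    Measure.pi μ {x' | ∀ i, p i → x' i = x i} = ∏ i with p i, μ i {x i} := by
  have hset : {x' | ∀ i, p i → x' i = x i} =
      Set.univ.pi fun i => if p i then {x i} else Set.univ := by
    ext x'
    simp only [Set.mem_ofPred_eq, Set.mem_univ_pi]
    refine forall_congr' fun i => ?_
    split_ifs with hi <;> simp [hi]
  rw [hset, Measure.pi_pi, Finset.prod_filter]
  refine Finset.prod_congr rfl fun i _ => ?_
  split_ifs
  · rfl
  · exact measure_univ

end Symbols

section Input

variable {K N Nr Nt : ℕ} (s : System K N Nr Nt)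

/-- The law of each entry of the input `x_e`. -/
noncomputable def System.symbolLaw (e : s.Element) : Measure ℂ :=
  uniformOn (s.constellation e : Set ℂ)

/-- Every constellation is nonempty and has variance at most `1`, a weakening of `UnitEnergy` that
suffices for the bound on the mutual information. -/
def System.VarianceLeOne : Prop :=
  ∀ e, (s.constellation e).Nonempty ∧ ∫ z, ‖z - ∫ w, w ∂s.symbolLaw e‖ ^ 2 ∂s.symbolLaw e ≤ 1

variable {s}

lemma System.UnitEnergy.varianceLeOne (hunit : s.UnitEnergy) : s.VarianceLeOne := by
  intro e
  have hne : (s.constellation e).Nonempty := by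
    by_contra! hempty
    simpa [hempty] using hunit e
  refine ⟨hne, ?_⟩
  have : IsProbabilityMeasure (s.symbolLaw e) :=
    isProbabilityMeasure_uniformOn (Finset.finite_toSet _) hne
  calc ∫ z, ‖z - ∫ w, w ∂s.symbolLaw e‖ ^ 2 ∂s.symbolLaw e
      ≤ ∫ z, ‖z‖ ^ 2 ∂s.symbolLaw e :=
        integral_norm_sub_integral_sq_le (memLp_uniformOn (s.constellation e) 2)
    _ = (∑ z ∈ s.constellation e, ‖z‖ ^ 2) / ((s.constellation e).card : ℝ) :=
        integral_uniformOn _ _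
    _ = 1 := hunit e

lemma System.VarianceLeOne.isProbabilityMeasure_symbolLaw (hvar : s.VarianceLeOne)
    (e : s.Element) : IsProbabilityMeasure (s.symbolLaw e) :=
  isProbabilityMeasure_uniformOn (Finset.finite_toSet _) (hvar e).1

lemma System.VarianceLeOne.isProbabilityMeasure_inputLaw (hvar : s.VarianceLeOne)
    (A : Finset s.Element) : IsProbabilityMeasure (s.inputLaw A) := by
  have := hvar.isProbabilityMeasure_symbolLaw
  change IsProbabilityMeasure (Measure.pi fun e : A => Measure.pi fun _ => s.symbolLaw e)
  infer_instance

lemma System.VarianceLeOne.measurePreserving_symbol (hvar : s.VarianceLeOne)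
    (A : Finset s.Element) (e : A) (t : Fin Nt) :
    MeasurePreserving (fun x => x e t) (s.inputLaw A) (s.symbolLaw e) := by
  have := hvar.isProbabilityMeasure_symbolLaw
  exact (measurePreserving_eval (fun _ : Fin Nt => s.symbolLaw e) t).comp
    (measurePreserving_eval (fun e : A => Measure.pi fun _ : Fin Nt => s.symbolLaw e) e)

/-- The entries of the inputs `x_e`, `e ∈ A`, centred at their means. -/
noncomputable def System.centredSymbol (s : System K N Nr Nt) (A : Finset s.Element)
    (k : A × Fin Nt) (x : (e : A) → Fin Nt → ℂ) : ℂ :=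
  x k.1 k.2 - ∫ z, z ∂s.symbolLaw k.1

lemma System.measurable_centredSymbol (A : Finset s.Element) (k : A × Fin Nt) :
    Measurable (s.centredSymbol A k) := by
  unfold centredSymbol; fun_prop

lemma System.VarianceLeOne.iIndepFun_centredSymbol (hvar : s.VarianceLeOne)
    (A : Finset s.Element) : iIndepFun (s.centredSymbol A) (s.inputLaw A) := by
  have := hvar.isProbabilityMeasure_symbolLaw
  have hind := iIndepFun_uncurry_infinitePi' (fun (e : A) (_ : Fin Nt) => s.symbolLaw e)
    (X := fun (e : A) (_ : Fin Nt) z => z - ∫ w, w ∂s.symbolLaw e) (by fun_prop)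
  simp only [Measure.infinitePi_eq_pi] at hind
  exact hind

lemma System.VarianceLeOne.isSubOrthonormal_centredSymbol (hvar : s.VarianceLeOne)
    (A : Finset s.Element) : IsSubOrthonormal (s.centredSymbol A) (s.inputLaw A) := by
  have := hvar.isProbabilityMeasure_symbolLaw
  have hmem (e : s.Element) : MemLp (fun z => z - ∫ w, w ∂s.symbolLaw e) 2 (s.symbolLaw e) :=
    (memLp_uniformOn _ 2).sub (memLp_const _)
  refine isSubOrthonormal_of_iIndepFun
    (fun k => (hmem k.1).comp_measurePreserving (hvar.measurePreserving_symbol A k.1 k.2))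
    (hvar.iIndepFun_centredSymbol A) (fun k => ?_) fun k => ?_
  · have hpres := hvar.measurePreserving_symbol A k.1 k.2
    have hz : Integrable (fun z => z) (s.symbolLaw k.1) :=
      (memLp_uniformOn _ 2).integrable one_le_two
    have h := integral_map (μ := s.inputLaw A)
      (f := fun z => z - ∫ w, w ∂s.symbolLaw k.1) hpres.measurable.aemeasurable (by fun_prop)
    rw [hpres.map_eq, integral_sub hz (integrable_const _), integral_const, probReal_univ,
      one_smul, sub_self] at h
    exact h.symm
  · have hpres := hvar.measurePreserving_symbol A k.1 k.2
    have h := integral_map (μ := s.inputLaw A)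
      (f := fun z => ‖z - ∫ w, w ∂s.symbolLaw k.1‖ ^ 2) hpres.measurable.aemeasurable (by fun_prop)
    rw [hpres.map_eq] at h
    exact h.symm.trans_le (hvar k.1).2

lemma System.VarianceLeOne.ae_mem_constellation (hvar : s.VarianceLeOne) (A : Finset s.Element) :
    ∀ᵐ x ∂s.inputLaw A, ∀ (e : A) (t : Fin Nt), x e t ∈ s.constellation e := by
  refine ae_all_iff.2 fun e => ae_all_iff.2 fun t => ?_
  exact (hvar.measurePreserving_symbol A e t).quasiMeasurePreserving.ae
    (ae_cond_mem (s.constellation e).measurableSet)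

open Classical in
lemma System.VarianceLeOne.inputLaw_setOf_forall_eq (hvar : s.VarianceLeOne)
    (A R : Finset s.Element) {x : (e : A) → Fin Nt → ℂ}
    (hx : ∀ (e : A) (t : Fin Nt), x e t ∈ s.constellation e) :
    (∏ e : A with e.1 ∈ R, ((s.constellation e).card : ℝ≥0∞) ^ Nt) *
      s.inputLaw A {x' | ∀ e : A, e.1 ∈ R → x' e = x e} = 1 := by
  have := hvar.isProbabilityMeasure_symbolLaw
  have hsingleton (e : A) : Measure.pi (fun _ : Fin Nt => s.symbolLaw e) {x e} =
      (((s.constellation e).card : ℝ≥0∞) ^ Nt)⁻¹ := by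
    simp only [Measure.pi_singleton, symbolLaw, uniformOn_singleton_of_mem (hx e _),
      Finset.prod_const, Finset.card_univ, Fintype.card_fin, ENNReal.inv_pow]
  have hlaw : s.inputLaw A {x' | ∀ e : A, e.1 ∈ R → x' e = x e} =
      ∏ e : A with e.1 ∈ R, (((s.constellation e).card : ℝ≥0∞) ^ Nt)⁻¹ := by
    simp only [← hsingleton]
    exact pi_setOf_forall_eq (fun e : A => Measure.pi fun _ => s.symbolLaw e) (fun e => e.1 ∈ R) x
  rw [hlaw, ← Finset.prod_mul_distrib]
  refine Finset.prod_eq_one fun e _ => ENNReal.mul_inv_cancel (pow_ne_zero _ ?_) (by finiteness)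
  exact_mod_cast (hvar e).1.card_ne_zero

end Input

section Output

variable {K N Nr Nt : ℕ} (s : System K N Nr Nt)

/-- The amplitude `√p_e c_e(n)`. -/
noncomputable def System.gain (n : Fin N) (e : s.Element) : ℂ :=
  ((Real.sqrt (s.psd e) * s.alloc e n : ℝ) : ℂ)

lemma System.alloc_mul_self (e : s.Element) (n : Fin N) :
    s.alloc e n * s.alloc e n = s.alloc e n := by
  have hbit : ∀ c : Fin 2, ((c : ℕ) : ℝ) * ((c : ℕ) : ℝ) = ((c : ℕ) : ℝ) := by
    intro c; fin_cases c <;> simp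
  exact hbit _

variable {s} in
lemma System.gain_mul_star (hbudget : ∀ k, 0 ≤ s.budget k) (n : Fin N) (e : s.Element) :
    s.gain n e * star (s.gain n e) = ((s.psd e * s.alloc e n : ℝ) : ℂ) := by
  rw [gain, Complex.star_def, Complex.conj_ofReal, ← Complex.ofReal_mul, mul_mul_mul_comm,
    Real.mul_self_sqrt (psd_nonneg hbudget e), s.alloc_mul_self]

/-- The noise-free output on RB `n`. -/
noncomputable def System.signal (n : Fin N) (A : Finset s.Element) (x : (e : A) → Fin Nt → ℂ) :
    Fin Nr → ℂ :=
  ∑ e : A, s.gain n e • (s.effChannel n e *ᵥ x e)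

open Classical in
/-- The input with the symbols outside `R` replaced by their means. -/
noncomputable def System.partialMean (A R : Finset s.Element) (x : (e : A) → Fin Nt → ℂ)
    (e : A) : Fin Nt → ℂ :=
  if e.1 ∈ R then x e else fun _ => ∫ z, z ∂s.symbolLaw e

lemma System.measurable_signal_partialMean (n : Fin N) (A R : Finset s.Element) :
    Measurable fun x => s.signal n A (s.partialMean A R x) := by
  have hmean (e : A) : Measurable fun x => s.partialMean A R x e := by
    unfold partialMean
    split_ifs <;> fun_prop
  unfold signal
  fun_prop

open Classical in
/-- The matrix mapping the centred symbols to the part of the output that is due to the symbols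
outside `R`. -/
noncomputable def System.residualChannel (n : Fin N) (A R : Finset s.Element) :
    Matrix (Fin Nr) (A × Fin Nt) ℂ :=
  Matrix.of fun i k => if k.1.1 ∈ R then 0 else s.gain n k.1 * s.effChannel n k.1 i k.2

lemma System.signal_eq_add_residualChannel_mulVec (n : Fin N) (A R : Finset s.Element)
    (x : (e : A) → Fin Nt → ℂ) :
    s.signal n A x = s.signal n A (s.partialMean A R x) +
      s.residualChannel n A R *ᵥ fun k => s.centredSymbol A k x := by
  rw [← sub_eq_iff_eq_add']
  ext i
  simp only [signal, ← Finset.sum_sub_distrib, ← smul_sub, ← mulVec_sub, Finset.sum_apply,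
    Pi.smul_apply, mulVec, dotProduct, Fintype.sum_prod_type, smul_eq_mul, Finset.mul_sum]
  refine Finset.sum_congr rfl fun e _ => Finset.sum_congr rfl fun t _ => ?_
  by_cases he : e.1 ∈ R
  · simp [residualChannel, partialMean, he]
  · simp [residualChannel, partialMean, he, centredSymbol, mul_assoc]

variable {s}

open Classical in
lemma System.residualChannel_mul_conjTranspose (hbudget : ∀ k, 0 ≤ s.budget k) (n : Fin N)
    (A R : Finset s.Element) :
    s.residualChannel n A R * (s.residualChannel n A R)ᴴ = s.signalCov n (A \ R) := by
  ext i j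
  have hsdiff : A \ R = A.filter fun e => e ∉ R := by ext e; simp
  rw [signalCov, hsdiff, Finset.sum_filter, ← Finset.sum_coe_sort A]
  simp only [mul_apply, Matrix.sum_apply, Fintype.sum_prod_type]
  refine Finset.sum_congr rfl fun e _ => ?_
  by_cases he : e.1 ∈ R
  · simp [residualChannel, he]
  · simp only [residualChannel, he, not_false_eq_true, if_true, if_false, Matrix.smul_apply,
      mul_apply, conjTranspose_apply, of_apply, smul_eq_mul, Finset.mul_sum,
      ← gain_mul_star hbudget, star_mul]
    exact Finset.sum_congr rfl fun t _ => by ring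

open Classical in
lemma System.log_prod_card_pow (hvar : s.VarianceLeOne) {A R : Finset s.Element} (hR : R ⊆ A) :
    Real.log (∏ e : A with e.1 ∈ R, ((s.constellation e).card : ℝ) ^ Nt) =
      ∑ e ∈ R, (Nt : ℝ) * Real.log ((s.constellation e).card : ℝ) := by
  rw [Real.log_prod (f := fun e : A => ((s.constellation e).card : ℝ) ^ Nt)
    fun e _ => pow_ne_zero _ (Nat.cast_ne_zero.2 (hvar e).1.card_ne_zero)]
  simp only [Real.log_pow]
  have hsum := Finset.sum_coe_sort A fun e =>
    if e ∈ R then (Nt : ℝ) * Real.log ((s.constellation e).card : ℝ) else 0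
  rw [Finset.sum_ite_mem, Finset.inter_eq_right.2 hR] at hsum
  rw [← hsum, Finset.sum_filter]
  congr!

open Classical in
lemma System.info_le_of_subset (hbudget : ∀ k, 0 ≤ s.budget k) (hvar : s.VarianceLeOne)
    (n : Fin N) {A R : Finset s.Element} (hR : R ⊆ A) :
    s.info n A ≤ ENNReal.ofReal
      (s.logDet n (A \ R) + ∑ e ∈ R, (Nt : ℝ) * Real.log ((s.constellation e).card : ℝ)) := by
  have := hvar.isProbabilityMeasure_inputLaw A
  set M : NNReal := ∏ e : A with e.1 ∈ R, ((s.constellation e).card : NNReal) ^ Nt with hM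
  have hatom : ∀ᵐ x ∂s.inputLaw A, 1 ≤ M * s.inputLaw A
      {x' | s.signal n A (s.partialMean A R x') = s.signal n A (s.partialMean A R x)} := by
    filter_upwards [hvar.ae_mem_constellation A] with x hx
    rw [← hvar.inputLaw_setOf_forall_eq A R hx, hM]
    push_cast
    gcongr with x'
    intro h
    congr 1
    ext1 e
    unfold partialMean
    split_ifs with he
    exacts [h e he, rfl]
  have hbound := mutualInfo_channel_le (B := s.residualChannel n A R)
    (s.measurable_signal_partialMean n A R) (measurable_centredSymbol A)
    (hvar.isSubOrthonormal_centredSymbol A) hatom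
  have hlogDet : 0 ≤ s.logDet n (A \ R) :=
    (logDet_empty n).symm.trans_le (monotone_logDet hbudget n (Finset.empty_subset _))
  have hlogM : Real.log M = ∑ e ∈ R, (Nt : ℝ) * Real.log ((s.constellation e).card : ℝ) := by
    rw [← log_prod_card_pow hvar hR, hM]
    push_cast
    rfl
  have hweights : 0 ≤ ∑ e ∈ R, (Nt : ℝ) * Real.log ((s.constellation e).card : ℝ) :=
    Finset.sum_nonneg fun e _ => mul_nonneg (Nat.cast_nonneg _) (Real.log_natCast_nonneg _)
  simp only [← signal_eq_add_residualChannel_mulVec] at hbound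
  rw [residualChannel_mul_conjTranspose hbudget, hlogM, add_comm] at hbound
  rw [ENNReal.ofReal_add hlogDet hweights]
  exact hbound

lemma System.info_le_gRB (hbudget : ∀ k, 0 ≤ s.budget k) (hvar : s.VarianceLeOne) (n : Fin N)
    (A : Finset s.Element) : s.info n A ≤ ENNReal.ofReal (s.gRB n A) := by
  classical
  obtain ⟨R, hR, hmin⟩ := Finset.exists_mem_eq_inf' ⟨∅, Finset.empty_mem_powerset A⟩ fun R =>
    s.logDet n (A \ R) + ∑ e ∈ R, (Nt : ℝ) * Real.log ((s.constellation e).card : ℝ)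
  rw [gRB, hmin]
  exact info_le_of_subset hbudget hvar n (Finset.mem_powerset.1 hR)

end Output

end Uplink

theorem proposition1_general {K N Nr Nt : ℕ} (s : Uplink.System K N Nr Nt)
    (hbudget : ∀ k, 0 ≤ s.budget k) (hvar : s.VarianceLeOne) :
    (∀ (n : Fin N) (A : Finset s.Element), s.info n A ≤ ENNReal.ofReal (s.gRB n A)) ∧
      Uplink.IsRankFunction s.g :=
  ⟨Uplink.System.info_le_gRB hbudget hvar, Uplink.System.isRankFunction_g hbudget⟩

theorem proposition1 {K N Nr Nt : ℕ} (s : Uplink.System K N Nr Nt)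
    (hbudget : ∀ k, 0 ≤ s.budget k) (hunit : s.UnitEnergy) :
    (∀ (n : Fin N) (A : Finset s.Element), s.info n A ≤ ENNReal.ofReal (s.gRB n A)) ∧
      Uplink.IsRankFunction s.g :=
  proposition1_general s hbudget hunit.varianceLeOne
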